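/- Let $(\Omega,\mathcal F,\mathbb P)$ be a probability space. Let $l=(l(t),\,t\ge 0)$ be a real-valued Lévy process, that is: $l(0)=0$ a.s., $l$ has independent and stationary increments, is stochastically continuous, and has a.s. càdlàg paths. Let $l$ have Lévy triplet $(\gamma,b,\nu)$, where $\gamma\in\mathbb R$, $b\ge 0$ and $\nu$ is a measure on $\mathbb R$ with $\int_{\mathbb R}\min(y^2,1)\,\nu(dy)<\infty$; that is, $\mathbb E(e^{i\xi l(1)})=e^{\psi(\xi)}$ for all $\xi\in\mathbb R$, with the characteristic exponent $$\psi(\xi)=i\gamma\xi-\frac b2\xi^2+\int_{\mathbb R\setminus\{0\}}\big(e^{i\xi y}-1-i\xi y\,\mathbf 1_{\{|y|\le 1\}}\big)\,\nu(dy).$$ Let $\mathcal D\subset\mathbb R^d$ and let $W=(W(x),\,x\in\mathcal D)$ be a Gaussian random field (a family of real random variables whose finite-dimensional distributions are all multivariate Gaussian) such that the processes $l$ and $W$ are independent. Put $\mu_W(x)=\mathbb E(W(x))$ and $\sigma_W(x)^2=\mathrm{Var}(W(x))$. Let $F:\mathbb R\to[0,\infty)$ be measurable and $L(x)=l(F(W(x)))$.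 Then for every $x\in\mathcal D$ with $\sigma_W(x)^2>0$ and every $\xi\in\mathbb R$, $L(x)$ is a random variable (measurable up to a $\mathbb P$-null set), the integral on the right-hand side below converges absolutely, and the characteristic function of $L(x)$ satisfies $$\phi_{L(x)}(\xi)=\mathbb E\big(e^{i\xi L(x)}\big)=\frac{1}{\sqrt{2\pi\sigma_W(x)^2}}\int_{\mathbb R}\exp\Big(F(y)\psi(\xi)-\frac{(y-\mu_W(x))^2}{2\sigma_W(x)^2}\Big)\,dy .$$ -/

import Mathlib

open MeasureTheory ProbabilityTheory Filter Topology
open scoped NNReal ENNReal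

namespace GSLF

/-- A function on `[0, ∞)` is càdlàg if it is right-continuous and has (finite) left limits. -/
def IsCadlag (f : ℝ≥0 → ℝ) : Prop :=
  ∀ t, ContinuousWithinAt f (Set.Ici t) t ∧ ∃ a, Tendsto f (𝓝[<] t) (𝓝 a)

/-- A real-valued Lévy process `l = (l t, t ≥ 0)` on the probability space `(Ω, P)`. -/
structure IsLevyProcess {Ω : Type*} {mΩ : MeasurableSpace Ω}
    (l : ℝ≥0 → Ω → ℝ) (P : Measure Ω) : Prop where
  measurable : ∀ t, Measurable (l t)
  zero : ∀ᵐ ω ∂P, l 0 ω = 0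
  indep_increments : HasIndepIncrements l P
  stationary_increments : ∀ s t : ℝ≥0, s ≤ t →
    IdentDistrib (fun ω ↦ l t ω - l s ω) (l (t - s)) P P
  stochastically_continuous : ∀ s : ℝ≥0, TendstoInMeasure P l (𝓝 s) (l s)
  cadlag : ∀ᵐ ω ∂P, IsCadlag (fun t ↦ l t ω)

/-- `ν` is a Lévy measure: `∫ min (y², 1) ν(dy) < ∞`. -/
def IsLevyMeasure (ν : Measure ℝ) : Prop :=
  ∫⁻ y, ENNReal.ofReal (min (y ^ 2) 1) ∂ν < ∞

/-- The Lévy–Khinchin characteristic exponent of the triplet `(γ, b, ν)`,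
`ψ(ξ) = iγξ - (b/2) ξ² + ∫_{ℝ ∖ {0}} (e^{iξy} - 1 - iξy 1_{|y| ≤ 1}) ν(dy)`. -/
noncomputable def charExponent (γ : ℝ) (b : ℝ≥0) (ν : Measure ℝ) (ξ : ℝ) : ℂ :=
  Complex.I * γ * ξ - (b : ℂ) / 2 * (ξ : ℂ) ^ 2
    + ∫ y in ({0}ᶜ : Set ℝ),
        (Complex.exp (Complex.I * ξ * y) - 1
          - {z : ℝ | |z| ≤ 1}.indicator (fun z : ℝ ↦ Complex.I * ξ * z) y) ∂ν

/-- The process `l` has Lévy triplet `(γ, b, ν)`: `ν` is a Lévy measure and the law of `l 1`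
has characteristic function `exp ψ`. For a Lévy process this determines the characteristic
functions of all `l t`. -/
structure HasLevyTriplet {Ω : Type*} {mΩ : MeasurableSpace Ω}
    (l : ℝ≥0 → Ω → ℝ) (P : Measure Ω) (γ : ℝ) (b : ℝ≥0) (ν : Measure ℝ) : Prop where
  isLevyMeasure : IsLevyMeasure ν
  charFun_one : ∀ ξ : ℝ, charFun (P.map (l 1)) ξ = Complex.exp (charExponent γ b ν ξ)

/-- A Gaussian random field indexed by `D`: a family of real random variables all of whose
finite-dimensional distributions are (possibly degenerate) multivariate Gaussians. -/
structure IsGaussianRandomField {Ω : Type*} {mΩ : MeasurableSpace Ω} {d : ℕ}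
    {D : Set (EuclideanSpace ℝ (Fin d))} (W : D → Ω → ℝ) (P : Measure Ω) : Prop where
  measurable : ∀ x, Measurable (W x)
  gaussian : IsGaussianProcess W P

/-- The Gaussian subordinated Lévy field `L(x) = l(F(W(x)))`. -/
def gslf {Ω D : Type*} (l : ℝ≥0 → Ω → ℝ) (F : ℝ → ℝ≥0) (W : D → Ω → ℝ) (x : D) (ω : Ω) : ℝ :=
  l (F (W x ω)) ω

end GSLF

namespace GSLF

/-! ### The characteristic exponent -/

/-! Put `τ = F(W(x))`, a random time independent of `l`. Conditioning on `τ` should give `E exp(iξ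
l(τ)) = E exp(τ ψ(ξ))`, and integrating against the Gaussian law of `W(x)` gives the formula. The
triplet only prescribes the law of `l 1`, so `E exp(iξ l(t)) = exp(t ψ(ξ))` is derived for rational
`t` (`charFun_div`) from independent stationary increments and continuity of `ψ`. That is enough:
`τ` is rounded up to a grid, where conditioning is Fubini over a countable set of times
(`integral_exp_eval_gridCeil`). Right-continuity of the paths and dominated convergence then remove
the grid (`integral_exp_eval`). -/

lemma norm_exp_I_mul_sub_one_sub_le (u : ℝ) :
    ‖Complex.exp (Complex.I * u) - 1 - Complex.I * u‖ ≤ 3 * u ^ 2 := by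
  have hn : ‖Complex.I * (u : ℂ)‖ = |u| := by simp
  rcases le_total |u| 1 with h | h
  · have := Complex.exp_bound_sq 0 (Complex.I * u) (by rwa [hn])
    simp only [zero_add, Complex.exp_zero, smul_eq_mul, mul_one, norm_one, one_mul, hn,
      sq_abs] at this
    nlinarith [sq_nonneg u]
  · have h1 : ‖Complex.exp (Complex.I * u) - 1‖ ≤ |u| := Real.norm_exp_I_mul_ofReal_sub_one_le
    calc _ ≤ ‖Complex.exp (Complex.I * u) - 1‖ + ‖Complex.I * (u : ℂ)‖ := norm_sub_le _ _
      _ ≤ 3 * u ^ 2 := by rw [hn, ← sq_abs u]; nlinarith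

lemma norm_exp_I_mul_sub_one_le_two (u : ℝ) : ‖Complex.exp (Complex.I * u) - 1‖ ≤ 2 := by
  calc _ ≤ ‖Complex.exp (Complex.I * u)‖ + ‖(1 : ℂ)‖ := norm_sub_le _ _
    _ = 2 := by rw [mul_comm, Complex.norm_exp_ofReal_mul_I, norm_one]; norm_num

/-- The compensated integrand of the Lévy–Khinchin formula. -/
noncomputable def levyIntegrand (ξ y : ℝ) : ℂ :=
  Complex.exp (Complex.I * ξ * y) - 1
    - {z : ℝ | |z| ≤ 1}.indicator (fun z : ℝ ↦ Complex.I * ξ * z) y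

lemma norm_levyIntegrand_le (ξ y : ℝ) :
    ‖levyIntegrand ξ y‖ ≤ (3 * ξ ^ 2 + 2) * min (y ^ 2) 1 := by
  have hu : Complex.I * ξ * y = Complex.I * ((ξ * y : ℝ) : ℂ) := by push_cast; ring
  by_cases hy : |y| ≤ 1
  · have hy2 : y ^ 2 ≤ 1 := by rw [← sq_abs]; nlinarith [abs_nonneg y]
    have := norm_exp_I_mul_sub_one_sub_le (ξ * y)
    rw [levyIntegrand, Set.indicator_of_mem (by exact hy), hu, min_eq_left hy2]
    nlinarith [sq_nonneg y]
  · have hy2 : 1 ≤ y ^ 2 := by rw [← sq_abs]; nlinarith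
    have := norm_exp_I_mul_sub_one_le_two (ξ * y)
    rw [levyIntegrand, Set.indicator_of_notMem (by exact hy), hu, min_eq_right hy2, sub_zero]
    nlinarith [sq_nonneg ξ]

lemma measurable_levyIntegrand (ξ : ℝ) : Measurable (levyIntegrand ξ) := by
  unfold levyIntegrand
  refine Measurable.sub (by fun_prop) (Measurable.indicator (by fun_prop) ?_)
  exact measurableSet_le (by fun_prop) (by fun_prop)

lemma continuous_levyIntegrand (y : ℝ) : Continuous (fun ξ ↦ levyIntegrand ξ y) := by
  by_cases hy : |y| ≤ 1
  · simp only [levyIntegrand, Set.indicator_of_mem (show y ∈ {z : ℝ | |z| ≤ 1} from hy)]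
    fun_prop
  · simp only [levyIntegrand, Set.indicator_of_notMem (show y ∉ {z : ℝ | |z| ≤ 1} from hy)]
    fun_prop

lemma IsLevyMeasure.integrable {ν : Measure ℝ} (hν : IsLevyMeasure ν) :
    Integrable (fun y : ℝ ↦ min (y ^ 2) 1) ν := by
  refine ⟨by fun_prop, ?_⟩
  rw [hasFiniteIntegral_iff_ofReal (ae_of_all _ fun y ↦ by positivity)]
  exact hν

lemma IsLevyMeasure.continuous_charExponent {ν : Measure ℝ} (hν : IsLevyMeasure ν)
    (γ : ℝ) (b : ℝ≥0) : Continuous (charExponent γ b ν) := by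
  have key : Continuous (fun ξ : ℝ ↦ ∫ y in ({0}ᶜ : Set ℝ), levyIntegrand ξ y ∂ν) := by
    refine continuous_iff_continuousAt.2 fun ξ₀ ↦ ?_
    -- The bound is uniform over the neighbourhood `|ξ| ≤ |ξ₀| + 1` of `ξ₀`.
    refine continuousAt_of_dominated
      (bound := fun y ↦ (3 * (|ξ₀| + 1) ^ 2 + 2) * min (y ^ 2) 1)
      (Eventually.of_forall fun ξ ↦ (measurable_levyIntegrand ξ).aestronglyMeasurable) ?_
      (hν.integrable.restrict.const_mul _)
      (ae_of_all _ fun y ↦ (continuous_levyIntegrand y).continuousAt)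
    filter_upwards [continuous_abs.continuousAt.eventually_le_const (lt_add_one |ξ₀|)] with ξ hξ
    refine ae_of_all _ fun y ↦ (norm_levyIntegrand_le ξ y).trans ?_
    gcongr ?_ * _
    have : ξ ^ 2 ≤ (|ξ₀| + 1) ^ 2 := by
      rw [← sq_abs ξ]; gcongr
    linarith
  have h : charExponent γ b ν = fun ξ : ℝ ↦ Complex.I * γ * ξ - (b : ℂ) / 2 * (ξ : ℂ) ^ 2
      + ∫ y in ({0}ᶜ : Set ℝ), levyIntegrand ξ y ∂ν := rfl
  rw [h]
  fun_prop

lemma charExponent_zero (γ : ℝ) (b : ℝ≥0) (ν : Measure ℝ) : charExponent γ b ν 0 = 0 := by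
  simp [charExponent]

/-! ### Characteristic functions of the one-dimensional marginals -/

/-- A continuous `n`-th root of the function `1` that equals `1` at the origin is constant. -/
lemma eq_one_of_pow_eq_one {g : ℝ → ℂ} (hg : Continuous g) {n : ℕ} (hn : 0 < n)
    (hpow : ∀ ξ, g ξ ^ n = 1) (h0 : g 0 = 1) (ξ : ℝ) : g ξ = 1 := by
  have hfin : (Set.range g).Finite := by
    refine (Polynomial.nthRootsFinset n (1 : ℂ)).finite_toSet.subset ?_
    rintro _ ⟨η, rfl⟩
    exact (Polynomial.mem_nthRootsFinset hn 1).2 (hpow η)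
  have hsub : (Set.range g).Subsingleton := by
    by_contra h
    exact (isPreconnected_range hg).infinite_of_nontrivial (Set.not_subsingleton_iff.1 h) hfin
  exact (hsub ⟨ξ, rfl⟩ ⟨0, rfl⟩).trans h0

variable {Ω : Type*} {mΩ : MeasurableSpace Ω} {P : Measure Ω} [IsProbabilityMeasure P]
  {l : ℝ≥0 → Ω → ℝ}

lemma IsLevyProcess.charFun_add (hl : IsLevyProcess l P) (s t : ℝ≥0) (ξ : ℝ) :
    charFun (P.map (l (s + t))) ξ = charFun (P.map (l s)) ξ * charFun (P.map (l t)) ξ := by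
  -- Since `l 0 = 0` a.s., `l s` is itself the increment over `[0, s]`.
  have hind : IndepFun (l s) (l (s + t) - l s) P :=
    hl.indep_increments.indepFun_eval_sub (zero_le) (le_self_add) hl.zero
  have hst := (hl.stationary_increments s (s + t) le_self_add).map_eq
  rw [add_tsub_cancel_left] at hst
  have hsum : l (s + t) = l s + (l (s + t) - l s) := by simp
  rw [hsum, hind.charFun_map_add_eq_mul (hl.measurable s).aemeasurable
    ((hl.measurable _).sub (hl.measurable s)).aemeasurable, Pi.mul_apply, ← hst]
  rfl

lemma IsLevyProcess.charFun_nsmul (hl : IsLevyProcess l P) (k : ℕ) (t : ℝ≥0) (ξ : ℝ) :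
    charFun (P.map (l (k * t))) ξ = charFun (P.map (l t)) ξ ^ k := by
  induction k with
  | zero =>
    have h0 : l 0 =ᵐ[P] fun _ ↦ (0 : ℝ) := hl.zero
    simp [Measure.map_congr h0, Measure.map_const]
  | succ k ih =>
    rw [Nat.cast_succ, add_mul, one_mul, hl.charFun_add, ih, pow_succ]

variable {γ : ℝ} {b : ℝ≥0} {ν : Measure ℝ}

/-- The `n`-th power of the left side is `exp ψ`, which fixes it only up to an `n`-th root of unity.
Its quotient by `exp (ψ / n)` is continuous in `ξ` and equals `1` at `0`, so that root is `1`. -/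
lemma HasLevyTriplet.charFun_inv (hT : HasLevyTriplet l P γ b ν) (hl : IsLevyProcess l P)
    {n : ℕ} (hn : 0 < n) (ξ : ℝ) :
    charFun (P.map (l (n : ℝ≥0)⁻¹)) ξ = Complex.exp (charExponent γ b ν ξ / n) := by
  have hprob : IsProbabilityMeasure (P.map (l (n : ℝ≥0)⁻¹)) :=
    Measure.isProbabilityMeasure_map (hl.measurable _).aemeasurable
  have hn' : (n : ℂ) ≠ 0 := by exact_mod_cast hn.ne'
  have hcont := hT.isLevyMeasure.continuous_charExponent γ b
  have key := eq_one_of_pow_eq_one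
    (g := fun η ↦ charFun (P.map (l (n : ℝ≥0)⁻¹)) η * Complex.exp (-(charExponent γ b ν η / n)))
    (continuous_charFun.mul (by fun_prop)) hn (fun η ↦ ?_) (by simp [charExponent_zero]) ξ
  · rw [Complex.exp_neg] at key
    exact (mul_inv_eq_one₀ (Complex.exp_ne_zero _)).1 key
  · have h1 : (n : ℝ≥0) * (n : ℝ≥0)⁻¹ = 1 := mul_inv_cancel₀ (by exact_mod_cast hn.ne')
    rw [mul_pow, ← hl.charFun_nsmul, h1, hT.charFun_one, ← Complex.exp_nat_mul, ← Complex.exp_add,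
      mul_neg, mul_div_cancel₀ _ hn', add_neg_cancel, Complex.exp_zero]

lemma HasLevyTriplet.charFun_div (hT : HasLevyTriplet l P γ b ν) (hl : IsLevyProcess l P)
    (k : ℕ) {n : ℕ} (hn : 0 < n) (ξ : ℝ) :
    charFun (P.map (l (k / n))) ξ
      = Complex.exp (((k / n : ℝ≥0) : ℂ) * charExponent γ b ν ξ) := by
  rw [div_eq_mul_inv, hl.charFun_nsmul, hT.charFun_inv hl hn, ← Complex.exp_nat_mul]
  congr 1
  push_cast
  ring

/-- A characteristic function has modulus at most `1`. This supplies the domination in every later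
limit and integral involving `exp (t ψ)`. -/
lemma HasLevyTriplet.re_charExponent_nonpos (hT : HasLevyTriplet l P γ b ν)
    (hl : IsLevyProcess l P) (ξ : ℝ) : (charExponent γ b ν ξ).re ≤ 0 := by
  have hprob : IsProbabilityMeasure (P.map (l 1)) :=
    Measure.isProbabilityMeasure_map (hl.measurable _).aemeasurable
  have h := norm_charFun_le_one (μ := P.map (l 1)) ξ
  rwa [hT.charFun_one, Complex.norm_exp, Real.exp_le_one_iff] at h

lemma HasLevyTriplet.norm_exp_mul_le_one (hT : HasLevyTriplet l P γ b ν)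
    (hl : IsLevyProcess l P) (t : ℝ≥0) (ξ : ℝ) :
    ‖Complex.exp ((t : ℂ) * charExponent γ b ν ξ)‖ ≤ 1 := by
  have h : ((t : ℂ) * charExponent γ b ν ξ).re = (t : ℝ) * (charExponent γ b ν ξ).re :=
    Complex.re_ofReal_mul _ _
  rw [Complex.norm_exp, Real.exp_le_one_iff, h]
  exact mul_nonpos_of_nonneg_of_nonpos t.2 (hT.re_charExponent_nonpos hl ξ)

/-! ### Evaluation at an independent random time -/

/-- The upper approximation of `t` by multiples of `1 / (n + 1)`. -/
noncomputable def gridCeil (n : ℕ) (t : ℝ≥0) : ℝ≥0 := ⌈t * (n + 1 : ℕ)⌉₊ / (n + 1 : ℕ)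

lemma le_gridCeil (n : ℕ) (t : ℝ≥0) : t ≤ gridCeil n t :=
  (le_div_iff₀ (by positivity)).2 (Nat.le_ceil _)

/-- The grid rounds up so that convergence is from the right, the side on which càdlàg paths are
continuous. -/
lemma tendsto_gridCeil (t : ℝ≥0) : Tendsto (fun n ↦ gridCeil n t) atTop (𝓝[≥] t) := by
  refine tendsto_nhdsWithin_iff.2 ⟨?_, Eventually.of_forall fun n ↦ le_gridCeil n t⟩
  have h1 : Tendsto (fun n : ℕ ↦ t + ((n + 1 : ℕ) : ℝ≥0)⁻¹) atTop (𝓝 (t + 0)) :=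
    tendsto_const_nhds.add
      (tendsto_inv_atTop_nhds_zero_nat (𝕜 := ℝ≥0).comp (tendsto_add_atTop_nat 1))
  rw [add_zero] at h1
  refine tendsto_of_tendsto_of_tendsto_of_le_of_le tendsto_const_nhds h1
    (fun n ↦ le_gridCeil n t) (fun n ↦ ?_)
  have hpos : (0 : ℝ≥0) < (n + 1 : ℕ) := by positivity
  refine (div_le_iff₀ hpos).2 ((Nat.ceil_lt_add_one zero_le).le.trans_eq ?_)
  rw [add_mul, inv_mul_cancel₀ hpos.ne']

lemma measurable_gridCeil (n : ℕ) : Measurable (gridCeil n) := by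
  unfold gridCeil
  fun_prop

/-- Only countably many times occur, so measurability of each `l t` suffices and joint measurability
in `(t, ω)` is not needed. -/
lemma measurable_eval_gridCeil (hl : ∀ t, Measurable (l t)) {τ : Ω → ℝ≥0} (hτ : Measurable τ)
    (n : ℕ) : Measurable (fun ω ↦ l (gridCeil n (τ ω)) ω) := by
  have h : Measurable (fun p : ℕ × Ω ↦ l (p.1 / (n + 1 : ℕ)) p.2) := by
    refine measurable_from_prod_countable_right fun k ↦ ?_
    exact hl (k / (n + 1 : ℕ))
  have hN : Measurable (fun ω ↦ ⌈τ ω * (n + 1 : ℕ)⌉₊) :=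
    Nat.measurable_ceil.comp (hτ.mul_const _)
  have hNω : Measurable (fun ω ↦ (⌈τ ω * (n + 1 : ℕ)⌉₊, ω)) := hN.prodMk measurable_id
  simpa only [gridCeil, Function.comp_def] using h.comp hNω

omit [IsProbabilityMeasure P] in
lemma IsLevyProcess.tendsto_eval_gridCeil (hl : IsLevyProcess l P) (τ : Ω → ℝ≥0) :
    ∀ᵐ ω ∂P, Tendsto (fun n ↦ l (gridCeil n (τ ω)) ω) atTop (𝓝 (l (τ ω) ω)) := by
  filter_upwards [hl.cadlag] with ω hω
  exact Tendsto.comp (g := fun t ↦ l t ω) (hω (τ ω)).1 (tendsto_gridCeil (τ ω))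

omit [IsProbabilityMeasure P] in
lemma IsLevyProcess.aemeasurable_eval (hl : IsLevyProcess l P) {τ : Ω → ℝ≥0}
    (hτ : Measurable τ) : AEMeasurable (fun ω ↦ l (τ ω) ω) P :=
  aemeasurable_of_tendsto_metrizable_ae atTop
    (fun n ↦ (measurable_eval_gridCeil hl.measurable hτ n).aemeasurable)
    (hl.tendsto_eval_gridCeil τ)

lemma HasLevyTriplet.integral_exp_eval_gridCeil (hT : HasLevyTriplet l P γ b ν)
    (hl : IsLevyProcess l P) {τ : Ω → ℝ≥0} (hτ : Measurable τ)
    (hind : IndepFun (fun ω t ↦ l t ω) τ P) (ξ : ℝ) (n : ℕ) :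
    ∫ ω, Complex.exp (Complex.I * ξ * (l (gridCeil n (τ ω)) ω : ℂ)) ∂P
      = ∫ ω, Complex.exp ((gridCeil n (τ ω) : ℂ) * charExponent γ b ν ξ) ∂P := by
  -- The grid index `N` is a function of `τ` and the sampled path `Y` a function of `l`, so they are
  -- independent and their joint law is a product.
  let N : Ω → ℕ := fun ω ↦ ⌈τ ω * (n + 1 : ℕ)⌉₊
  let Y : Ω → ℕ → ℝ := fun ω k ↦ l (k / (n + 1 : ℕ)) ω
  have hN : Measurable N := Nat.measurable_ceil.comp (hτ.mul_const _)
  have hY : Measurable Y := measurable_pi_lambda _ fun k ↦ hl.measurable _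
  have hNY : IndepFun N Y P :=
    (hind.comp (φ := fun (f : ℝ≥0 → ℝ) (k : ℕ) ↦ f (k / (n + 1 : ℕ)))
      (ψ := fun t : ℝ≥0 ↦ ⌈t * (n + 1 : ℕ)⌉₊)
      (measurable_pi_lambda _ fun k ↦ measurable_pi_apply (k / (n + 1 : ℕ) : ℝ≥0))
      (Nat.measurable_ceil.comp (measurable_id.mul_const _))).symm
  have hmap := (indepFun_iff_map_prod_eq_prod_map_map hN.aemeasurable hY.aemeasurable).1 hNY
  have hPN : IsProbabilityMeasure (P.map N) := Measure.isProbabilityMeasure_map hN.aemeasurable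
  have hPY : IsProbabilityMeasure (P.map Y) := Measure.isProbabilityMeasure_map hY.aemeasurable
  let G : ℕ × (ℕ → ℝ) → ℂ := fun p ↦ Complex.exp (Complex.I * ξ * (p.2 p.1 : ℂ))
  have hG : Measurable G := measurable_from_prod_countable_right fun k ↦ by
    simp only [G]
    fun_prop
  have hGint : Integrable G ((P.map N).prod (P.map Y)) := by
    refine Integrable.of_bound hG.aestronglyMeasurable 1 (ae_of_all _ fun p ↦ ?_)
    have : Complex.I * ξ * (p.2 p.1 : ℂ) = ((ξ * p.2 p.1 : ℝ) : ℂ) * Complex.I := by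
      push_cast; ring
    simp only [G, this, Complex.norm_exp_ofReal_mul_I, le_refl]
  have hinner (k : ℕ) : ∫ f, G (k, f) ∂(P.map Y)
      = Complex.exp (((k / (n + 1 : ℕ) : ℝ≥0) : ℂ) * charExponent γ b ν ξ) := by
    rw [integral_map hY.aemeasurable
        (show AEStronglyMeasurable (fun f ↦ G (k, f)) _ from
          (hG.comp measurable_prodMk_left).aestronglyMeasurable), ← hT.charFun_div hl k n.succ_pos ξ,
      charFun_apply_real, integral_map (hl.measurable _).aemeasurable (by fun_prop)]
    refine integral_congr_ae (ae_of_all _ fun ω ↦ ?_)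
    simp only [G, Y]
    congr 1
    ring
  calc _ = ∫ ω, G (N ω, Y ω) ∂P := rfl
    _ = ∫ p, G p ∂(P.map fun ω ↦ (N ω, Y ω)) :=
        (integral_map (hN.prodMk hY).aemeasurable hG.aestronglyMeasurable).symm
    _ = ∫ k, ∫ f, G (k, f) ∂(P.map Y) ∂(P.map N) := by rw [hmap, integral_prod _ hGint]
    _ = ∫ k : ℕ, Complex.exp (((k / (n + 1 : ℕ) : ℝ≥0) : ℂ) * charExponent γ b ν ξ) ∂(P.map N) := by
        simp_rw [hinner]
    _ = _ := integral_map hN.aemeasurable (measurable_from_top).aestronglyMeasurable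

/-- The characteristic function of a Lévy process evaluated at an independent random time. -/
lemma HasLevyTriplet.integral_exp_eval (hT : HasLevyTriplet l P γ b ν)
    (hl : IsLevyProcess l P) {τ : Ω → ℝ≥0} (hτ : Measurable τ)
    (hind : IndepFun (fun ω t ↦ l t ω) τ P) (ξ : ℝ) :
    ∫ ω, Complex.exp (Complex.I * ξ * (l (τ ω) ω : ℂ)) ∂P
      = ∫ ω, Complex.exp ((τ ω : ℂ) * charExponent γ b ν ξ) ∂P := by
  have h1 : Tendsto
      (fun n ↦ ∫ ω, Complex.exp (Complex.I * ξ * (l (gridCeil n (τ ω)) ω : ℂ)) ∂P)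
      atTop (𝓝 (∫ ω, Complex.exp (Complex.I * ξ * (l (τ ω) ω : ℂ)) ∂P)) := by
    refine tendsto_integral_of_dominated_convergence (fun _ ↦ (1 : ℝ)) (fun n ↦ ?_)
      (integrable_const _) (fun n ↦ ae_of_all _ fun ω ↦ ?_) ?_
    · have := measurable_eval_gridCeil hl.measurable hτ n
      have hc : Continuous (fun y : ℝ ↦ Complex.exp (Complex.I * ξ * (y : ℂ))) := by fun_prop
      exact (hc.measurable.comp this).aestronglyMeasurable
    · have : Complex.I * ξ * (l (gridCeil n (τ ω)) ω : ℂ)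
          = ((ξ * l (gridCeil n (τ ω)) ω : ℝ) : ℂ) * Complex.I := by
        push_cast; ring
      rw [this, Complex.norm_exp_ofReal_mul_I]
    · filter_upwards [hl.tendsto_eval_gridCeil τ] with ω hω
      have hc : Continuous (fun y : ℝ ↦ Complex.exp (Complex.I * ξ * (y : ℂ))) := by fun_prop
      exact (hc.tendsto _).comp hω
  have h2 : Tendsto
      (fun n ↦ ∫ ω, Complex.exp ((gridCeil n (τ ω) : ℂ) * charExponent γ b ν ξ) ∂P)
      atTop (𝓝 (∫ ω, Complex.exp ((τ ω : ℂ) * charExponent γ b ν ξ) ∂P)) := by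
    refine tendsto_integral_of_dominated_convergence (fun _ ↦ (1 : ℝ)) (fun n ↦ ?_)
      (integrable_const _) (fun n ↦ ae_of_all _ fun ω ↦ hT.norm_exp_mul_le_one hl _ ξ)
      (ae_of_all _ fun ω ↦ ?_)
    · have := (measurable_gridCeil n).comp hτ
      simp only [Function.comp_def] at this
      exact Measurable.aestronglyMeasurable (by fun_prop)
    · have hc : Continuous
          (fun t : ℝ≥0 ↦ Complex.exp (((t : ℝ) : ℂ) * charExponent γ b ν ξ)) := by
        fun_prop
      exact (hc.tendsto _).comp ((tendsto_gridCeil (τ ω)).mono_right nhdsWithin_le_nhds)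
  simp_rw [hT.integral_exp_eval_gridCeil hl hτ hind ξ] at h1
  exact tendsto_nhds_unique h1 h2

/-! ### Integration against a Gaussian density -/

lemma gaussianPDFReal_smul_exp (m : ℝ) (v : ℝ≥0) (z : ℂ) (y : ℝ) :
    gaussianPDFReal m v y • Complex.exp z
      = ((1 / √(2 * Real.pi * v) : ℝ) : ℂ)
        * Complex.exp (z - ((y : ℂ) - (m : ℂ)) ^ 2 / (2 * ((v : ℝ) : ℂ))) := by
  rw [gaussianPDFReal, Complex.real_smul, Complex.ofReal_mul, one_div, mul_assoc,
    Complex.ofReal_exp, ← Complex.exp_add]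
  congr 2
  push_cast
  ring

lemma integrable_exp_sub_sq_div {h : ℝ → ℂ} (hh : Measurable h)
    (hbound : ∀ y, ‖Complex.exp (h y)‖ ≤ 1) (m : ℝ) {v : ℝ≥0} (hv : 0 < v) :
    Integrable (fun y : ℝ ↦
      Complex.exp (h y - ((y : ℂ) - (m : ℂ)) ^ 2 / (2 * ((v : ℝ) : ℂ)))) := by
  have hc : ((1 / √(2 * Real.pi * v) : ℝ) : ℂ) ≠ 0 := by
    have : (0 : ℝ) < v := hv
    exact Complex.ofReal_ne_zero.2 (by positivity)
  -- With the normalising constant restored, the integrand is the Gaussian density times a factor of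
  -- modulus at most `1`.
  refine (integrable_const_mul_iff (isUnit_iff_ne_zero.2 hc) _).1 ?_
  simp_rw [← gaussianPDFReal_smul_exp]
  have hexp : Measurable fun y ↦ Complex.exp (h y) := by fun_prop
  refine (integrable_gaussianPDFReal m v).mono
    ((measurable_gaussianPDFReal m v).smul hexp).aestronglyMeasurable
    (ae_of_all _ fun y ↦ ?_)
  rw [norm_smul]
  exact mul_le_of_le_one_right (norm_nonneg _) (hbound y)

end GSLF

open GSLF in
theorem mainTheorem2 {Ω : Type*} {mΩ : MeasurableSpace Ω} (P : Measure Ω)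
    [IsProbabilityMeasure P] {d : ℕ} {D : Set (EuclideanSpace ℝ (Fin d))}
    (l : ℝ≥0 → Ω → ℝ) (hl : GSLF.IsLevyProcess l P)
    (γ : ℝ) (b : ℝ≥0) (ν : Measure ℝ) (hT : GSLF.HasLevyTriplet l P γ b ν)
    (W : D → Ω → ℝ) (hW : GSLF.IsGaussianRandomField W P)
    (hlW : IndepFun (fun ω t ↦ l t ω) (fun ω x ↦ W x ω) P)
    (F : ℝ → ℝ≥0) (hF : Measurable F)
    (x : D) (hσ : 0 < variance (W x) P) (ξ : ℝ) :
    AEMeasurable (GSLF.gslf l F W x) P ∧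
    Integrable (fun y : ℝ ↦ Complex.exp ((F y : ℂ) * GSLF.charExponent γ b ν ξ
      - ((y : ℂ) - ((∫ ω, W x ω ∂P : ℝ) : ℂ)) ^ 2 / (2 * (variance (W x) P : ℂ)))) ∧
    charFun (P.map (GSLF.gslf l F W x)) ξ
      = ∫ ω, Complex.exp (Complex.I * ξ * (GSLF.gslf l F W x ω : ℂ)) ∂P ∧
    ∫ ω, Complex.exp (Complex.I * ξ * (GSLF.gslf l F W x ω : ℂ)) ∂P
      = ((1 / √(2 * Real.pi * variance (W x) P) : ℝ) : ℂ)
        * ∫ y : ℝ, Complex.exp ((F y : ℂ) * GSLF.charExponent γ b ν ξ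
          - ((y : ℂ) - ((∫ ω, W x ω ∂P : ℝ) : ℂ)) ^ 2 / (2 * (variance (W x) P : ℂ))) := by
  have hτ : Measurable (fun ω ↦ F (W x ω)) := hF.comp (hW.measurable x)
  have hmeas : AEMeasurable (gslf l F W x) P := hl.aemeasurable_eval hτ
  have hind : IndepFun (fun ω t ↦ l t ω) (fun ω ↦ F (W x ω)) P :=
    hlW.comp measurable_id (hF.comp (measurable_pi_apply x))
  have hv : 0 < (variance (W x) P).toNNReal := Real.toNNReal_pos.2 hσ
  have hcoe : ((variance (W x) P).toNNReal : ℝ) = variance (W x) P :=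
    Real.coe_toNNReal _ hσ.le
  refine ⟨hmeas, ?_, ?_, ?_⟩
  · have h := integrable_exp_sub_sq_div (h := fun y ↦ (F y : ℂ) * charExponent γ b ν ξ)
      (by fun_prop) (fun y ↦ hT.norm_exp_mul_le_one hl (F y) ξ) (∫ ω, W x ω ∂P) hv
    rwa [hcoe] at h
  · rw [charFun_apply_real, integral_map hmeas (by fun_prop)]
    refine integral_congr_ae (ae_of_all _ fun ω ↦ ?_)
    simp only
    ring_nf
  · have hlaw := (hW.gaussian.hasGaussianLaw_eval x).map_eq_gaussianReal
    have hexp : Measurable fun y ↦ Complex.exp ((F y : ℂ) * charExponent γ b ν ξ) := by fun_prop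
    calc _ = ∫ ω, Complex.exp ((F (W x ω) : ℂ) * charExponent γ b ν ξ) ∂P :=
          hT.integral_exp_eval hl hτ hind ξ
      _ = ∫ y, Complex.exp ((F y : ℂ) * charExponent γ b ν ξ) ∂(P.map (W x)) :=
          (integral_map (hW.measurable x).aemeasurable hexp.aestronglyMeasurable).symm
      _ = _ := by
          rw [hlaw, integral_gaussianReal_eq_integral_smul hv.ne']
          simp_rw [gaussianPDFReal_smul_exp, hcoe]
          rw [integral_const_mul]
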